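/- Let $N\ge 1$ and $k\in\{0,\dots,N\}$. For a compact convex set $K\subset\mathbb{R}^N$ let $V_0(K),\dots,V_N(K)$ be its intrinsic volumes, that is, the coefficients in the Steiner formula $$\mathrm{vol}_N\big(\{x:\mathrm{dist}(x,K)\le\varepsilon\}\big)=\sum_{i=0}^N V_i(K)\,\omega_{N-i}\,\varepsilon^{N-i}\qquad(\varepsilon\ge0),$$ where $\omega_j$ is the volume of the unit ball of $\mathbb{R}^j$; and $V_i(\varnothing)=0$. Let $\mathcal{C}^N$ be the set of all functions $f:\mathbb{R}^N\to[0,\infty)$ such that for every $t>0$ the level set $L_t(f)=\{x\in\mathbb{R}^N: f(x)\ge t\}$ is compact and convex (possibly empty). Let $\nu$ be a Radon measure on $(0,\infty)$, that is, a (non-negative) Borel measure which is finite on compact subsets of $(0,\infty)$, and assume that $$\int_{(0,\infty)}V_k(L_t(f))\,d\nu(t)<\infty\qquad\text{for every } f\in\mathcal{C}^N.$$ Define $\mu:\mathcal{C}^N\to\mathbb{R}$ by $\mu(f)=\int_{(0,\infty)}V_k(L_t(f))\,d\nu(t)$. Then the following two conditions are equivalent: (i) $\nu$ is non-atomic, i.e.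 $\nu(\{t\})=0$ for every $t>0$; (ii) $\mu$ is continuous in the following sense: whenever $f_i$, $i\in\mathbb{N}$, is a sequence in $\mathcal{C}^N$ which is pointwise increasing in $i$ or pointwise decreasing in $i$ and converges pointwise in $\mathbb{R}^N$ to some $f\in\mathcal{C}^N$, then $\mu(f_i)\to\mu(f)$. -/

import Mathlib

namespace QuasiConcave

open MeasureTheory Filter Topology

/-- `ω_j`, the volume of the unit ball of `ℝ^j` (so `ω_0 = 1`). -/
noncomputable def unitBallVolume (j : ℕ) : ℝ :=
  (volume : Measure (EuclideanSpace ℝ (Fin j))).real (Metric.closedBall 0 1)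

/-- `v 0, …, v N` are the coefficients of the Steiner formula of `K`: for all `ε ≥ 0`, the volume of
the parallel set `K_ε = {x | dist(x, K) ≤ ε}` is `∑ i, v i * ω_{N-i} * ε ^ (N-i)`.
For `K = ∅` the parallel sets are empty, so all the coefficients are `0`. -/
def IsSteinerCoefficients {N : ℕ} (K : Set (EuclideanSpace ℝ (Fin N))) (v : Fin (N + 1) → ℝ) :
    Prop :=
  ∀ ε : ℝ, 0 ≤ ε →
    (volume : Measure (EuclideanSpace ℝ (Fin N))).real (Metric.cthickening ε K) =
      ∑ i : Fin (N + 1), v i * unitBallVolume (N - i) * ε ^ (N - (i : ℕ))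

theorem unitBallVolume_pos (j : ℕ) : 0 < unitBallVolume j := by
  unfold unitBallVolume Measure.real
  exact ENNReal.toReal_pos (Metric.measure_closedBall_pos volume _ one_pos).ne'
    (isCompact_closedBall _ _).measure_lt_top.ne

/-- The coefficients in the Steiner formula of a set are unique. -/
theorem IsSteinerCoefficients.unique {N : ℕ} {K : Set (EuclideanSpace ℝ (Fin N))}
    {v w : Fin (N + 1) → ℝ} (hv : IsSteinerCoefficients K v) (hw : IsSteinerCoefficients K w) :
    v = w := by
  let P : Polynomial ℝ := ∑ i : Fin (N + 1),
    Polynomial.monomial (N - (i : ℕ)) ((v i - w i) * unitBallVolume (N - i))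
  have hP : P = 0 := by
    refine Polynomial.eq_zero_of_infinite_isRoot P
      (Set.Infinite.mono (s := Set.Ici (0 : ℝ)) ?_ (Set.Ici_infinite 0))
    intro ε hε
    have h := (hv ε hε).symm.trans (hw ε hε)
    show P.eval ε = 0
    simp only [P, Polynomial.eval_finsetSum, Polynomial.eval_monomial, sub_mul,
      Finset.sum_sub_distrib]
    linarith
  funext i
  have hc : P.coeff (N - (i : ℕ)) = (v i - w i) * unitBallVolume (N - i) := by
    simp only [P, Polynomial.finsetSum_coeff, Polynomial.coeff_monomial]
    rw [Finset.sum_eq_single i]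
    · simp
    · intro j _ hj
      rw [if_neg]
      intro h
      exact hj (Fin.ext (by omega))
    · simp
  rw [hP, Polynomial.coeff_zero] at hc
  have := (mul_eq_zero.mp hc.symm).resolve_right (unitBallVolume_pos _).ne'
  linarith

open Classical in
/-- The `k`-th intrinsic volume `V_k(K)` of a compact convex set `K ⊆ ℝ^N`, `k = 0, …, N`: the
`k`-th coefficient in the Steiner formula of `K`. In particular `V_k(∅) = 0`. (Sets without
a Steiner formula get the value `0`; compact convex sets all have one.) -/
noncomputable def intrinsicVolume {N : ℕ} (k : Fin (N + 1)) (K : Set (EuclideanSpace ℝ (Fin N))) :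
    ℝ :=
  if h : ∃ v : Fin (N + 1) → ℝ, IsSteinerCoefficients K v then h.choose k else 0

/-- The level set `L_t(f) = {x | f x ≥ t}`. -/
def levelSet {N : ℕ} (t : ℝ) (f : EuclideanSpace ℝ (Fin N) → ℝ) : Set (EuclideanSpace ℝ (Fin N)) :=
  {x | t ≤ f x}

/-- The class `𝒞^N` of quasi-concave functions: the non-negative functions on `ℝ^N` all of whose
level sets `L_t(f)`, `t > 0`, are convex bodies or empty, that is, compact and convex. -/
def QuasiConcaveFunction (N : ℕ) : Type :=
  {f : EuclideanSpace ℝ (Fin N) → ℝ //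
    (∀ x, 0 ≤ f x) ∧ ∀ t : ℝ, 0 < t → IsCompact (levelSet t f) ∧ Convex ℝ (levelSet t f)}

/-- Continuity of a functional on `𝒞^N`: whenever a sequence in `𝒞^N`, increasing or decreasing,
converges pointwise to an element of `𝒞^N`, the values of the functional converge. -/
def IsMonotoneContinuous {N : ℕ} (μ : QuasiConcaveFunction N → ℝ) : Prop :=
  ∀ (f : ℕ → QuasiConcaveFunction N) (g : QuasiConcaveFunction N),
    (Monotone (fun i => (f i).1) ∨ Antitone (fun i => (f i).1)) →
    (∀ x, Tendsto (fun i => (f i).1 x) atTop (𝓝 (g.1 x))) →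
    Tendsto (fun i => μ (f i)) atTop (𝓝 (μ g))

/-- The functional `μ(f) = ∫_{(0,∞)} V_k(L_t(f)) dν(t)` on `𝒞^N`. -/
noncomputable def integralValuation {N : ℕ} (k : Fin (N + 1)) (ν : Measure (Set.Ioi (0 : ℝ)))
    (f : QuasiConcaveFunction N) : ℝ :=
  ∫ t : Set.Ioi (0 : ℝ), intrinsicVolume k (levelSet (t : ℝ) f.1) ∂ν

end QuasiConcave

/-! The core is Steiner's formula. If `p` is the nearest point map of `K`, then `x ↦ (1 - r) p x + r
x` maps the parallel set at distance 1 bijectively onto the one at distance `r`. Its Jacobian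
determinant is positive and polynomial in `r` of degree at most `N`, so the volume of the parallel
set is such a polynomial. By interpolation, `V_k` is a fixed linear combination of the volumes of
the parallel sets at distances `1, …, N + 1` (`intrinsicVolume_eq_sum`), and limits of `V_k` reduce
to limits of these volumes.

Non-atomic implies continuous, by dominated convergence. Along decreasing sequences the level sets
converge at every `t`; along increasing ones, off a countable set of `t`, which is `ν`-null. For the
bound, `V_0` is monotone, while for `k ≥ 1` integrability forces `ν` to vanish near 0
(`exists_measure_lt_eq_zero`), leaving only a compact range of levels.

Conversely, for the unit ball `B` and `a_i ↑ s` with `a_i < s`, the functions `a_i 1_B` increase to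
`s 1_B`, but `μ` stays at least `ν {s} V_k(B)` below its value at the limit. -/

namespace QuasiConcave

open MeasureTheory Filter Topology

/-! ### Nearest point maps and change of variables along normal rays -/

section NearestPoint

variable {E : Type*} [NormedAddCommGroup E] [InnerProductSpace ℝ E]

/-- `p` is the nearest point map of the convex set `K`, in variational form. -/
structure IsNearestPointMap (K : Set E) (p : E → E) : Prop where
  mem : ∀ x, p x ∈ K
  inner_le : ∀ x, ∀ w ∈ K, inner ℝ (x - p x) (w - p x) ≤ 0

theorem exists_isNearestPointMap {K : Set E} (hne : K.Nonempty) (hc : IsComplete K)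
    (hK : Convex ℝ K) : ∃ p, IsNearestPointMap K p := by
  choose p hp hp' using exists_norm_eq_iInf_of_complete_convex hne hc hK
  exact ⟨p, hp, fun x => (norm_eq_iInf_iff_real_inner_le_zero hK (hp x)).1 (hp' x)⟩

namespace IsNearestPointMap

variable {K : Set E} {p : E → E}

/-- Add the variational inequalities at `x` and `y`, each tested against the other's projection.
This firm nonexpansiveness gives the Lipschitz bound and, for the derivative, positivity of the
Jacobian. -/
theorem norm_sq_le_inner (hp : IsNearestPointMap K p) (x y : E) :
    ‖p x - p y‖ ^ 2 ≤ inner ℝ (p x - p y) (x - y) := by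
  have h1 := hp.inner_le x (p y) (hp.mem y)
  have h2 := hp.inner_le y (p x) (hp.mem x)
  rw [← real_inner_self_eq_norm_sq]
  simp only [inner_sub_left, inner_sub_right] at *
  have e1 := real_inner_comm x (p x)
  have e2 := real_inner_comm x (p y)
  have e3 := real_inner_comm y (p x)
  have e4 := real_inner_comm y (p y)
  linarith

theorem lipschitzWith (hp : IsNearestPointMap K p) : LipschitzWith 1 p := by
  refine LipschitzWith.of_dist_le_mul fun x y => ?_
  rw [dist_eq_norm, dist_eq_norm, NNReal.coe_one, one_mul]
  have h := (hp.norm_sq_le_inner x y).trans (real_inner_le_norm _ _)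
  rcases (norm_nonneg (p x - p y)).eq_or_lt' with h0 | h0
  · rw [h0]; positivity
  · rw [sq] at h
    exact le_of_mul_le_mul_left h h0

theorem eq_of_inner_le (hp : IsNearestPointMap K p) {x y : E} (hy : y ∈ K)
    (h : ∀ w ∈ K, inner ℝ (x - y) (w - y) ≤ 0) : p x = y := by
  have h1 := hp.inner_le x y hy
  have h2 := h (p x) (hp.mem x)
  have : inner ℝ (p x - y) (p x - y) ≤ 0 := by
    simp only [inner_sub_left, inner_sub_right] at *
    linarith
  exact sub_eq_zero.1 (inner_self_eq_zero.1 (this.antisymm real_inner_self_nonneg))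

theorem norm_sub_le (hp : IsNearestPointMap K p) (x : E) {w : E} (hw : w ∈ K) :
    ‖x - p x‖ ≤ ‖x - w‖ := by
  have h := hp.inner_le x w hw
  have e : x - w = (x - p x) - (w - p x) := by abel
  refine abs_le_of_sq_le_sq' ?_ (norm_nonneg _) |>.2
  have := norm_sub_sq_real (x - p x) (w - p x)
  rw [e]
  nlinarith [sq_nonneg ‖w - p x‖]

theorem mem_cthickening_iff (hp : IsNearestPointMap K p) (hK : IsCompact K) {r : ℝ} (hr : 0 ≤ r)
    {x : E} : x ∈ Metric.cthickening r K ↔ ‖x - p x‖ ≤ r := by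
  rw [hK.cthickening_eq_biUnion_closedBall hr]
  simp only [Set.mem_iUnion, Metric.mem_closedBall, dist_eq_norm, exists_prop]
  exact ⟨fun ⟨w, hw, h⟩ => (hp.norm_sub_le x hw).trans h, fun h => ⟨p x, hp.mem x, h⟩⟩

/-- The map moving every point along its normal ray to `K`, multiplying the distance to `K`
by `r`. -/
def normalScaling (p : E → E) (r : ℝ) (x : E) : E := (1 - r) • p x + r • x

theorem normalScaling_sub (r : ℝ) (x : E) : normalScaling p r x - p x = r • (x - p x) := by
  unfold normalScaling; module

/-- The vectors `v` with `⟪v, w - p x⟫ ≤ 0` for all `w ∈ K` form a cone, so scaling `x - p x` does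
not move the projection. -/
theorem apply_normalScaling (hp : IsNearestPointMap K p) {r : ℝ} (hr : 0 ≤ r) (x : E) :
    p (normalScaling p r x) = p x := by
  refine hp.eq_of_inner_le (hp.mem x) fun w hw => ?_
  rw [normalScaling_sub, real_inner_smul_left]
  exact mul_nonpos_of_nonneg_of_nonpos hr (hp.inner_le x w hw)

theorem normalScaling_inv (hp : IsNearestPointMap K p) {r : ℝ} (hr : 0 < r) (x : E) :
    normalScaling p r⁻¹ (normalScaling p r x) = x := by
  have : normalScaling p r⁻¹ (normalScaling p r x) =
      p (normalScaling p r x) + r⁻¹ • (normalScaling p r x - p (normalScaling p r x)) := by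
    rw [← normalScaling_sub]; abel
  rw [this, hp.apply_normalScaling hr.le, normalScaling_sub, smul_smul, inv_mul_cancel₀ hr.ne']
  module

theorem injective_normalScaling (hp : IsNearestPointMap K p) {r : ℝ} (hr : 0 < r) :
    Function.Injective (normalScaling p r) :=
  Function.LeftInverse.injective (hp.normalScaling_inv hr)

theorem image_normalScaling (hp : IsNearestPointMap K p) (hK : IsCompact K) {r : ℝ} (hr : 0 < r) :
    normalScaling p r '' Metric.cthickening 1 K = Metric.cthickening r K := by
  have key : ∀ {s : ℝ}, 0 < s → ∀ x, ‖normalScaling p s x - p (normalScaling p s x)‖ =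
      s * ‖x - p x‖ := fun {s} hs x => by
    rw [hp.apply_normalScaling hs.le, normalScaling_sub, norm_smul, Real.norm_of_nonneg hs.le]
  ext y
  rw [hp.mem_cthickening_iff hK hr.le]
  constructor
  · rintro ⟨x, hx, rfl⟩
    rw [hp.mem_cthickening_iff hK zero_le_one] at hx
    rw [key hr]
    nlinarith
  · intro hy
    refine ⟨normalScaling p r⁻¹ y, ?_, ?_⟩
    · rw [hp.mem_cthickening_iff hK zero_le_one, key (inv_pos.2 hr), inv_mul_le_one₀ hr]
      exact hy
    · simpa using hp.normalScaling_inv (inv_pos.2 hr) y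

theorem norm_sq_le_inner_of_hasFDerivAt (hp : IsNearestPointMap K p) {x : E} {A : E →L[ℝ] E}
    (hA : HasFDerivAt p A x) (v : E) : ‖A v‖ ^ 2 ≤ inner ℝ (A v) v := by
  have h := hA.lim_real v
  refine le_of_tendsto_of_tendsto (h.norm.pow 2) (h.inner tendsto_const_nhds) ?_
  filter_upwards [eventually_gt_atTop 0] with c hc
  have := hp.norm_sq_le_inner (x + c⁻¹ • v) x
  rw [add_sub_cancel_left, inner_smul_right] at this
  rw [norm_smul, mul_pow, real_inner_smul_left, Real.norm_of_nonneg hc.le]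
  calc c ^ 2 * ‖p (x + c⁻¹ • v) - p x‖ ^ 2
      ≤ c ^ 2 * (c⁻¹ * inner ℝ (p (x + c⁻¹ • v) - p x) v) := by gcongr
    _ = _ := by field_simp

end IsNearestPointMap

/-- If `A` is firmly nonexpansive, then `(1 - r) A + r id` is injective for all `r > 0`. -/
theorem eq_zero_of_interpolation_apply_eq_zero {A : E →L[ℝ] E}
    (hA : ∀ v, ‖A v‖ ^ 2 ≤ inner ℝ (A v) v) {r : ℝ} (hr : 0 < r) {v : E}
    (hv : ((1 - r) • A + r • ContinuousLinearMap.id ℝ E) v = 0) : v = 0 := by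
  have h1 := hA v
  have h2 : (1 - r) * inner ℝ (A v) v + r * ‖v‖ ^ 2 = 0 := by
    have := congrArg (fun w => inner ℝ w v) hv
    simpa [inner_add_left, real_inner_smul_left] using this
  have h3 := real_inner_le_norm (A v) v
  have h4 : ‖A v‖ ≤ ‖v‖ := by
    by_contra! h
    nlinarith [norm_nonneg v, norm_nonneg (A v)]
  have h5 : inner ℝ (A v) v ≤ ‖v‖ ^ 2 := by nlinarith [norm_nonneg v]
  have h6 : 0 ≤ inner ℝ (A v) v := (sq_nonneg _).trans h1
  have h7 : ‖v‖ ^ 2 ≤ 0 := by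
    -- Here `0 ≤ ⟪A v, v⟫ ≤ ‖v‖ ^ 2`. For `r ≤ 1` both terms of `h2` are nonnegative; for `r ≥ 1`
    -- their sum is at least `‖v‖ ^ 2`.
    rcases le_total r 1 with h | h
    · have : r * ‖v‖ ^ 2 ≤ 0 := by nlinarith [mul_nonneg (sub_nonneg.2 h) h6]
      exact nonpos_of_mul_nonpos_right this hr
    · nlinarith [mul_le_mul_of_nonneg_left h5 (sub_nonneg.2 h)]
  exact norm_eq_zero.1 (pow_eq_zero_iff two_ne_zero |>.1 (h7.antisymm (sq_nonneg _)))

variable [FiniteDimensional ℝ E]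

theorem exists_polynomial_eval_eq_det (A : E →L[ℝ] E) :
    ∃ P : Polynomial ℝ, P.natDegree ≤ Module.finrank ℝ E ∧
      ∀ r : ℝ, P.eval r = ((1 - r) • A + r • ContinuousLinearMap.id ℝ E).det := by
  let b := Module.finBasis ℝ E
  let M := LinearMap.toMatrix b b (A : E →ₗ[ℝ] E)
  refine ⟨Matrix.det ((Polynomial.X : Polynomial ℝ) • (1 - M).map Polynomial.C +
    M.map Polynomial.C), ?_, fun r => ?_⟩
  · simpa using Polynomial.natDegree_det_X_add_C_le (1 - M) M
  · rw [ContinuousLinearMap.det, ← LinearMap.det_toMatrix b, ← Polynomial.coe_evalRingHom,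
      RingHom.map_det]
    congr 1
    ext i j
    by_cases hij : i = j <;> simp [M, hij] <;> ring

/-- The determinant is 1 at `r = 1` and has no zero on `(0, ∞)`, so it keeps its sign. Positivity
removes the absolute value in the change of variables, which would spoil polynomiality. -/
theorem det_interpolation_pos {A : E →L[ℝ] E} (hA : ∀ v, ‖A v‖ ^ 2 ≤ inner ℝ (A v) v) {r : ℝ}
    (hr : 0 < r) : 0 < ((1 - r) • A + r • ContinuousLinearMap.id ℝ E).det := by
  by_contra! h
  have hcont : Continuous fun s : ℝ => ((1 - s) • A + s • ContinuousLinearMap.id ℝ E).det :=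
    ContinuousLinearMap.continuous_det.comp (by fun_prop)
  obtain ⟨s, hs, h0⟩ := (isPreconnected_Ioi (a := (0 : ℝ))).intermediate_value hr
    (zero_lt_one : (0 : ℝ) < 1) hcont.continuousOn
    (show (0 : ℝ) ∈ Set.Icc _ _ from ⟨h, by simp [ContinuousLinearMap.det]⟩)
  obtain ⟨v, hv, hv0⟩ := (Submodule.ne_bot_iff _).1
    (LinearMap.bot_lt_ker_of_det_eq_zero (show LinearMap.det _ = 0 from h0)).ne'
  exact hv0 (eq_zero_of_interpolation_apply_eq_zero hA hs hv)

variable [MeasurableSpace E] [BorelSpace E]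

theorem LipschitzWith.addHaar_image_eq_zero {C : NNReal} {f : E → E} (hf : LipschitzWith C f)
    (μ : Measure E) [μ.IsAddHaarMeasure] {s : Set E} (hs : μ s = 0) : μ (f '' s) = 0 := by
  have h1 := Measure.isAddLeftInvariant_eq_smul μ (Measure.hausdorffMeasure (Module.finrank ℝ E))
  have h2 := Measure.isAddLeftInvariant_eq_smul (Measure.hausdorffMeasure (Module.finrank ℝ E)) μ
  have h3 : Measure.hausdorffMeasure (Module.finrank ℝ E) s = 0 := by
    rw [h2]; simp [hs]
  have h4 := hf.hausdorffMeasure_image_le (Nat.cast_nonneg (Module.finrank ℝ E)) s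
  rw [h3, mul_zero, nonpos_iff_eq_zero] at h4
  rw [h1]; simp [h4]

/-- The domain of integration does not depend on `r`. Rademacher's theorem makes the discarded
points a null set, and the Lipschitz scaling map sends it to a null set. -/
theorem IsNearestPointMap.measureReal_cthickening {K : Set E} {p : E → E}
    (hp : IsNearestPointMap K p) (hK : IsCompact K) (μ : Measure E) [μ.IsAddHaarMeasure] {r : ℝ}
    (hr : 0 < r) :
    IntegrableOn (fun x => ((1 - r) • fderiv ℝ p x + r • ContinuousLinearMap.id ℝ E).det)
      (Metric.cthickening 1 K ∩ {x | DifferentiableAt ℝ p x}) μ ∧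
    μ.real (Metric.cthickening r K) =
      ∫ x in Metric.cthickening 1 K ∩ {x | DifferentiableAt ℝ p x},
        ((1 - r) • fderiv ℝ p x + r • ContinuousLinearMap.id ℝ E).det ∂μ := by
  set D := Metric.cthickening 1 K ∩ {x | DifferentiableAt ℝ p x} with hD
  set T := normalScaling p r
  have hDm : MeasurableSet D :=
    Metric.isClosed_cthickening.measurableSet.inter (measurableSet_of_differentiableAt ℝ p)
  have hT : ∀ x ∈ D, HasFDerivWithinAt T
      ((1 - r) • fderiv ℝ p x + r • ContinuousLinearMap.id ℝ E) D x := fun x hx =>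
    ((hx.2.hasFDerivAt.const_smul (1 - r)).add
      ((hasFDerivAt_id x).const_smul r)).hasFDerivWithinAt
  have hpos : ∀ x ∈ D, |((1 - r) • fderiv ℝ p x + r • ContinuousLinearMap.id ℝ E).det| =
      ((1 - r) • fderiv ℝ p x + r • ContinuousLinearMap.id ℝ E).det := fun x hx =>
    abs_of_pos (det_interpolation_pos (hp.norm_sq_le_inner_of_hasFDerivAt hx.2.hasFDerivAt) hr)
  have hinj : Set.InjOn T D := (hp.injective_normalScaling hr).injOn
  have himg : μ (T '' D) = μ (Metric.cthickening r K) := by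
    rw [← hp.image_normalScaling hK hr]
    refine measure_eq_measure_of_null_sdiff (Set.image_mono Set.inter_subset_left) ?_
    rw [← Set.image_sdiff (hp.injective_normalScaling hr)]
    have hL : LipschitzWith (‖1 - r‖₊ * 1 + ‖r‖₊) T :=
      ((lipschitzWith_smul (1 - r)).comp hp.lipschitzWith).add (lipschitzWith_smul r)
    refine LipschitzWith.addHaar_image_eq_zero hL μ ?_
    refine measure_mono_null ?_ (hp.lipschitzWith.ae_differentiableAt (μ := μ))
    rintro x ⟨hx, hx'⟩ hd
    exact hx' ⟨hx, hd⟩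
  have hfin : μ (T '' D) ≠ ⊤ := by
    rw [himg]; exact hK.isBounded.cthickening.measure_lt_top.ne
  constructor
  · have h := (integrableOn_image_iff_integrableOn_abs_det_fderiv_smul μ hDm hT hinj
      (fun _ => (1 : ℝ))).1 (integrableOn_const hfin)
    refine h.congr_fun (fun x hx => ?_) hDm
    simp [hpos x hx]
  · have h := integral_image_eq_integral_abs_det_fderiv_smul μ hDm hT hinj (fun _ => (1 : ℝ))
    rw [setIntegral_congr_fun hDm (g := fun x =>
      ((1 - r) • fderiv ℝ p x + r • ContinuousLinearMap.id ℝ E).det)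
      (fun x hx => by simp [hpos x hx])] at h
    rw [← h, setIntegral_const, smul_eq_mul, mul_one, measureReal_def, measureReal_def, himg]

end NearestPoint

/-! ### Steiner's formula by Lagrange interpolation -/

variable {N : ℕ}

/-- The interpolation nodes `1, …, N + 1`. -/
noncomputable def steinerNode (j : Fin (N + 1)) : ℝ := (j : ℕ) + 1

theorem steinerNode_pos (j : Fin (N + 1)) : 0 < steinerNode j := by
  unfold steinerNode; positivity

theorem steinerNode_injective : Function.Injective (steinerNode (N := N)) := fun i j h => by
  simpa [steinerNode, Fin.ext_iff] using h

/-- The Lagrange basis polynomials at `1, …, N + 1`. -/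
noncomputable def steinerBasis (j : Fin (N + 1)) : Polynomial ℝ :=
  Lagrange.basis Finset.univ steinerNode j

theorem natDegree_steinerBasis (j : Fin (N + 1)) : (steinerBasis j).natDegree = N := by
  simpa [steinerBasis] using
    Lagrange.natDegree_basis (s := Finset.univ) (steinerNode_injective (N := N)).injOn
      (Finset.mem_univ j)

theorem eval_eq_sum_steinerBasis {P : Polynomial ℝ} (hP : P.natDegree ≤ N) (r : ℝ) :
    P.eval r = ∑ j : Fin (N + 1), P.eval (steinerNode j) * (steinerBasis j).eval r := by
  have h := Lagrange.eq_interpolate (s := Finset.univ) (f := P)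
    (steinerNode_injective (N := N)).injOn (by
      refine Polynomial.degree_le_natDegree.trans_lt ?_
      simp only [Finset.card_univ, Fintype.card_fin, Nat.cast_lt]
      omega)
  conv_lhs => rw [h]
  simp [Lagrange.interpolate_apply, Polynomial.eval_finsetSum, steinerBasis]

section

variable {K : Set (EuclideanSpace ℝ (Fin N))}

theorem volume_cthickening_eq_sum_of_pos (hK : IsCompact K) (hc : Convex ℝ K) {r : ℝ}
    (hr : 0 < r) : volume.real (Metric.cthickening r K) =
      ∑ j : Fin (N + 1), volume.real (Metric.cthickening (steinerNode j) K) *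
        (steinerBasis j).eval r := by
  rcases K.eq_empty_or_nonempty with rfl | hne
  · simp
  obtain ⟨p, hp⟩ := exists_isNearestPointMap hne hK.isComplete hc
  rw [(hp.measureReal_cthickening hK volume hr).2]
  simp_rw [fun j : Fin (N + 1) => (hp.measureReal_cthickening hK volume (steinerNode_pos j)).2,
    ← integral_mul_const]
  rw [← integral_finsetSum _ fun j _ =>
    (hp.measureReal_cthickening hK volume (steinerNode_pos j)).1.mul_const _]
  -- The interpolation identity already holds for the integrand at each `x`.
  refine integral_congr_ae (Eventually.of_forall fun x => ?_)
  obtain ⟨P, hP, hP'⟩ := exists_polynomial_eval_eq_det (fderiv ℝ p x)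
  simp only [← hP']
  exact eval_eq_sum_steinerBasis (by simpa using hP) r

theorem volume_cthickening_eq_sum (hK : IsCompact K) (hc : Convex ℝ K) {r : ℝ}
    (hr : 0 ≤ r) : volume.real (Metric.cthickening r K) =
      ∑ j : Fin (N + 1), volume.real (Metric.cthickening (steinerNode j) K) *
        (steinerBasis j).eval r := by
  rcases hr.eq_or_lt with rfl | hr
  -- The change of variables degenerates at `r = 0`; that case follows by right-continuity.
  · have h1 : Tendsto (fun r => volume.real (Metric.cthickening r K)) (𝓝[>] 0)
        (𝓝 (volume.real (Metric.cthickening 0 K))) := by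
      rw [Metric.cthickening_zero, hK.isClosed.closure_eq]
      exact ((ENNReal.tendsto_toReal hK.measure_lt_top.ne).comp
        (tendsto_measure_cthickening_of_isCompact hK)).mono_left nhdsWithin_le_nhds
    have h2 : Continuous fun r => ∑ j : Fin (N + 1),
        volume.real (Metric.cthickening (steinerNode j) K) * (steinerBasis j).eval r := by
      fun_prop
    refine tendsto_nhds_unique h1
      (((h2.tendsto 0).mono_left nhdsWithin_le_nhds).congr' ?_)
    filter_upwards [self_mem_nhdsWithin] with s hs
    exact (volume_cthickening_eq_sum_of_pos hK hc hs).symm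
  · exact volume_cthickening_eq_sum_of_pos hK hc hr

/-- The coefficients expressing the `k`-th intrinsic volume through the volumes of
parallel sets at distances `1, …, N + 1`. -/
noncomputable def steinerWeight (k j : Fin (N + 1)) : ℝ :=
  (steinerBasis j).coeff (N - k) / unitBallVolume (N - k)

/-- **Steiner's formula**. -/
theorem isSteinerCoefficients_sum (hK : IsCompact K) (hc : Convex ℝ K) :
    IsSteinerCoefficients K fun k => ∑ j : Fin (N + 1),
      volume.real (Metric.cthickening (steinerNode j) K) * steinerWeight k j := by
  intro r hr
  rw [volume_cthickening_eq_sum hK hc hr]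
  simp_rw [Finset.sum_mul]
  rw [Finset.sum_comm]
  refine Finset.sum_congr rfl fun j _ => ?_
  rw [Polynomial.eval_eq_sum_range' (n := N + 1) (by rw [natDegree_steinerBasis]; omega),
    ← Finset.sum_range_reflect, Finset.sum_range, Finset.mul_sum]
  refine Finset.sum_congr rfl fun i _ => ?_
  have := (unitBallVolume_pos (N - i)).ne'
  rw [steinerWeight, show N + 1 - 1 - (i : ℕ) = N - i by omega]
  field_simp

/-! ### Intrinsic volumes: bounds, `V_0`, and balls -/

theorem IsSteinerCoefficients.intrinsicVolume_eq {v : Fin (N + 1) → ℝ}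
    (hv : IsSteinerCoefficients K v) (k : Fin (N + 1)) : intrinsicVolume k K = v k := by
  have h : ∃ v, IsSteinerCoefficients K v := ⟨v, hv⟩
  rw [intrinsicVolume, dif_pos h, h.choose_spec.unique hv]

theorem isSteinerCoefficients_intrinsicVolume (hK : IsCompact K) (hc : Convex ℝ K) :
    IsSteinerCoefficients K fun k => intrinsicVolume k K := by
  have h := isSteinerCoefficients_sum hK hc
  simpa only [← h.intrinsicVolume_eq] using h

theorem intrinsicVolume_eq_sum (hK : IsCompact K) (hc : Convex ℝ K) (k : Fin (N + 1)) :
    intrinsicVolume k K = ∑ j : Fin (N + 1),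
      volume.real (Metric.cthickening (steinerNode j) K) * steinerWeight k j :=
  (isSteinerCoefficients_sum hK hc).intrinsicVolume_eq k

@[simp]
theorem intrinsicVolume_empty (k : Fin (N + 1)) :
    intrinsicVolume k (∅ : Set (EuclideanSpace ℝ (Fin N))) = 0 := by
  simp [intrinsicVolume_eq_sum isCompact_empty convex_empty]

theorem measureReal_cthickening_mono {K L : Set (EuclideanSpace ℝ (Fin N))} (hL : IsCompact L)
    (h : K ⊆ L) (r : ℝ) :
    volume.real (Metric.cthickening r K) ≤ volume.real (Metric.cthickening r L) :=
  measureReal_mono (Metric.cthickening_subset_of_subset r h)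
    hL.isBounded.cthickening.measure_lt_top.ne

/-- A substitute for monotonicity of `V_k`: the weights may have either sign, but the volumes they
multiply are monotone. -/
theorem exists_abs_intrinsicVolume_le {L : Set (EuclideanSpace ℝ (Fin N))} (hL : IsCompact L)
    (k : Fin (N + 1)) :
    ∃ C : ℝ, 0 ≤ C ∧ ∀ K ⊆ L, IsCompact K → Convex ℝ K → |intrinsicVolume k K| ≤ C := by
  refine ⟨∑ j : Fin (N + 1), volume.real (Metric.cthickening (steinerNode j) L) *
    |steinerWeight k j|, by positivity, fun K h hK hc => ?_⟩
  rw [intrinsicVolume_eq_sum hK hc]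
  refine (Finset.abs_sum_le_sum_abs _ _).trans (Finset.sum_le_sum fun j _ => ?_)
  rw [abs_mul, abs_of_nonneg measureReal_nonneg]
  exact mul_le_mul_of_nonneg_right (measureReal_cthickening_mono hL h _) (abs_nonneg _)

/-- With `ε = 1 / s`, multiplying by `s ^ N` turns the Steiner polynomial into `∑ V_i ω_{N-i} s ^
i`, whose constant term survives. Sign and monotonicity of `V_0` are thus inherited from volume. -/
theorem tendsto_volume_cthickening_mul_pow (hK : IsCompact K) (hc : Convex ℝ K) :
    Tendsto (fun s : ℝ => volume.real (Metric.cthickening s⁻¹ K) * s ^ N) (𝓝[>] 0)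
      (𝓝 (intrinsicVolume 0 K * unitBallVolume N)) := by
  have h : Continuous fun s : ℝ => ∑ i : Fin (N + 1),
      intrinsicVolume i K * unitBallVolume (N - i) * s ^ (i : ℕ) := by fun_prop
  have h0 := (h.tendsto 0).mono_left (nhdsWithin_le_nhds (s := Set.Ioi 0))
  rw [Fin.sum_univ_succ] at h0
  simp only [Fin.val_zero, Fin.val_succ, pow_zero, zero_pow (Nat.succ_ne_zero _), mul_zero,
    Finset.sum_const_zero, add_zero, mul_one, Nat.sub_zero] at h0
  refine h0.congr' ?_
  filter_upwards [self_mem_nhdsWithin] with s hs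
  have hs' : (0 : ℝ) < s := hs
  rw [isSteinerCoefficients_intrinsicVolume hK hc s⁻¹ (inv_pos.2 hs).le, Finset.sum_mul]
  refine Finset.sum_congr rfl fun i _ => ?_
  have : s ^ N = s ^ (N - (i : ℕ)) * s ^ (i : ℕ) := by
    rw [← pow_add]; congr 1; omega
  rw [this, inv_pow]
  field_simp

theorem intrinsicVolume_zero_nonneg (hK : IsCompact K) (hc : Convex ℝ K) :
    0 ≤ intrinsicVolume 0 K := by
  have h : 0 ≤ intrinsicVolume 0 K * unitBallVolume N := by
    refine ge_of_tendsto (tendsto_volume_cthickening_mul_pow hK hc) ?_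
    filter_upwards [self_mem_nhdsWithin] with s hs
    have : (0 : ℝ) < s := hs
    positivity
  exact nonneg_of_mul_nonneg_left h (unitBallVolume_pos N)

theorem intrinsicVolume_zero_mono {L : Set (EuclideanSpace ℝ (Fin N))} (hK : IsCompact K)
    (hc : Convex ℝ K) (hL : IsCompact L) (hc' : Convex ℝ L) (h : K ⊆ L) :
    intrinsicVolume 0 K ≤ intrinsicVolume 0 L := by
  refine le_of_mul_le_mul_right ?_ (unitBallVolume_pos N)
  refine le_of_tendsto_of_tendsto (tendsto_volume_cthickening_mul_pow hK hc)
    (tendsto_volume_cthickening_mul_pow hL hc') ?_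
  filter_upwards [self_mem_nhdsWithin] with s hs
  have : (0 : ℝ) < s := hs
  exact mul_le_mul_of_nonneg_right (measureReal_cthickening_mono hL h _) (by positivity)

theorem intrinsicVolume_closedBall {r : ℝ} (hr : 0 ≤ r) (k : Fin (N + 1)) :
    intrinsicVolume k (Metric.closedBall (0 : EuclideanSpace ℝ (Fin N)) r) =
      r ^ (k : ℕ) * (N.choose k * unitBallVolume N / unitBallVolume (N - k)) := by
  refine IsSteinerCoefficients.intrinsicVolume_eq (v := fun k : Fin (N + 1) =>
    r ^ (k : ℕ) * (N.choose k * unitBallVolume N / unitBallVolume (N - k))) (fun s hs => ?_) k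
  rw [cthickening_closedBall hs hr, Measure.addHaar_real_closedBall' _ _ (by positivity),
    finrank_euclideanSpace_fin, add_comm s r, add_pow, Finset.sum_range, Finset.sum_mul]
  refine Finset.sum_congr rfl fun i _ => ?_
  have := (unitBallVolume_pos (N - i)).ne'
  change _ * unitBallVolume N = _
  field_simp

/-! ### Limits of volumes of parallel sets -/

theorem tendsto_volume_cthickening_of_antitone {K : ℕ → Set (EuclideanSpace ℝ (Fin N))}
    (hK : ∀ i, IsCompact (K i)) (ha : Antitone K) {r : ℝ} (hr : 0 ≤ r) :
    Tendsto (fun i => volume.real (Metric.cthickening r (K i))) atTop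
      (𝓝 (volume.real (Metric.cthickening r (⋂ i, K i)))) := by
  have hI : IsCompact (⋂ i, K i) :=
    (hK 0).of_isClosed_subset (isClosed_iInter fun i => (hK i).isClosed) (Set.iInter_subset _ 0)
  have : Metric.cthickening r (⋂ i, K i) = ⋂ i, Metric.cthickening r (K i) := by
    refine Set.Subset.antisymm (Set.subset_iInter fun i =>
      Metric.cthickening_subset_of_subset r (Set.iInter_subset _ i)) fun x hx => ?_
    -- Points of `K i` within `r` of `x` form nested nonempty compact sets; a common point lies in
    -- the intersection.
    obtain ⟨y, hy⟩ := IsCompact.nonempty_iInter_of_sequence_nonempty_isCompact_isClosed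
      (fun i => K i ∩ Metric.closedBall x r)
      (fun i => Set.inter_subset_inter_left _ (ha (Nat.le_succ i))) (fun i => by
        have := Set.mem_iInter.1 hx i
        rw [(hK i).cthickening_eq_biUnion_closedBall hr] at this
        obtain ⟨y, hy, hxy⟩ := Set.mem_iUnion₂.1 this
        exact ⟨y, hy, Metric.mem_closedBall_comm.1 hxy⟩)
      ((hK 0).inter_right Metric.isClosed_closedBall)
      (fun i => (hK i).isClosed.inter Metric.isClosed_closedBall)
    rw [hI.cthickening_eq_biUnion_closedBall hr]
    rw [Set.mem_iInter] at hy
    exact Set.mem_iUnion₂.2 ⟨y, Set.mem_iInter.2 fun i => (hy i).1,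
      Metric.mem_closedBall_comm.1 (hy 0).2⟩
  rw [this]
  have hfin : ∀ i, volume (Metric.cthickening r (K i)) ≠ ⊤ := fun i =>
    (hK i).isBounded.cthickening.measure_lt_top.ne
  exact (ENNReal.tendsto_toReal
    ((measure_mono (Set.iInter_subset _ 0)).trans_lt (hfin 0).lt_top).ne).comp
    (tendsto_measure_iInter_atTop
      (fun i => Metric.isClosed_cthickening.measurableSet.nullMeasurableSet)
      (fun i j h => Metric.cthickening_subset_of_subset r (ha h)) ⟨0, hfin 0⟩)

/-- The difference is the frontier of a convex set. Open thickenings are needed because they commute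
with unions. -/
theorem measure_thickening_eq_cthickening (hc : Convex ℝ K) {r : ℝ} (hr : 0 < r) :
    volume (Metric.thickening r K) = volume (Metric.cthickening r K) := by
  refine measure_eq_measure_of_null_sdiff (Metric.thickening_subset_cthickening r K) ?_
  refine measure_mono_null ?_ ((hc.thickening r).addHaar_frontier volume)
  rw [frontier, closure_thickening hr, Metric.isOpen_thickening.interior_eq]

/-- If increasing compact sets `K i` inside a compact set cover a convex set `L`, the
volumes of their parallel sets are asymptotically at least those of `L`. -/
theorem eventually_lt_volume_cthickening {K : ℕ → Set (EuclideanSpace ℝ (Fin N))}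
    (hK : ∀ i, IsCompact (K i)) (hm : Monotone K) {L : Set (EuclideanSpace ℝ (Fin N))}
    (hc : Convex ℝ L) (hL : IsCompact L) (h : L ⊆ ⋃ i, K i) {r : ℝ} (hr : 0 < r) {a : ℝ}
    (ha : a < volume.real (Metric.cthickening r L)) :
    ∀ᶠ i in atTop, a < volume.real (Metric.cthickening r (K i)) := by
  rcases lt_or_ge a 0 with ha0 | ha0
  · exact Eventually.of_forall fun i => ha0.trans_le measureReal_nonneg
  have hfin : volume (Metric.cthickening r L) ≠ ⊤ :=
    hL.isBounded.cthickening.measure_lt_top.ne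
  have h1 : ENNReal.ofReal a < volume (⋃ i, Metric.thickening r (K i)) := by
    rw [← Metric.thickening_iUnion]
    calc ENNReal.ofReal a < volume (Metric.cthickening r L) :=
          (ENNReal.ofReal_lt_iff_lt_toReal ha0 hfin).2 ha
      _ = volume (Metric.thickening r L) := (measure_thickening_eq_cthickening hc hr).symm
      _ ≤ _ := measure_mono (Metric.thickening_subset_of_subset r h)
  have h2 := tendsto_measure_iUnion_atTop (μ := volume) (s := fun i => Metric.thickening r (K i))
    (fun i j hij => Metric.thickening_subset_of_subset r (hm hij))
  filter_upwards [h2.eventually_const_lt h1] with i hi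
  rw [measureReal_def, ← ENNReal.ofReal_lt_iff_lt_toReal ha0
    (hK i).isBounded.cthickening.measure_lt_top.ne]
  exact hi.trans_le (measure_mono (Metric.thickening_subset_cthickening r _))

end

/-! ### Level sets and their convergence -/

namespace QuasiConcaveFunction

theorem isCompact_levelSet (f : QuasiConcaveFunction N) (t : Set.Ioi (0 : ℝ)) :
    IsCompact (levelSet (t : ℝ) f.1) := (f.2.2 t t.2).1

theorem convex_levelSet (f : QuasiConcaveFunction N) (t : Set.Ioi (0 : ℝ)) :
    Convex ℝ (levelSet (t : ℝ) f.1) := (f.2.2 t t.2).2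

end QuasiConcaveFunction

theorem levelSet_subset_of_le {f g : EuclideanSpace ℝ (Fin N) → ℝ} (h : f ≤ g) (t : ℝ) :
    levelSet t f ⊆ levelSet t g := fun x hx => le_trans hx (h x)

theorem levelSet_antitone (f : EuclideanSpace ℝ (Fin N) → ℝ) : Antitone fun t => levelSet t f :=
  fun _ _ h _ hx => le_trans h hx

theorem QuasiConcaveFunction.exists_levelSet_eq_empty (f : QuasiConcaveFunction N) :
    ∃ M : ℝ, ∀ t, M ≤ t → levelSet t f.1 = ∅ := by
  by_contra! h
  have hne : ∀ n : ℕ, (levelSet ((n : ℝ) + 1) f.1).Nonempty := fun n => by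
    obtain ⟨t, ht, hx⟩ := h (n + 1)
    exact hx.mono (levelSet_antitone f.1 ht)
  have hcp : ∀ n : ℕ, IsCompact (levelSet ((n : ℝ) + 1) f.1) := fun n =>
    (f.2.2 _ (by positivity)).1
  obtain ⟨x, hx⟩ := IsCompact.nonempty_iInter_of_sequence_nonempty_isCompact_isClosed
    (fun n : ℕ => levelSet ((n : ℝ) + 1) f.1)
    (fun n => levelSet_antitone f.1 (by push_cast; linarith)) hne (hcp 0)
    (fun n => (hcp n).isClosed)
  obtain ⟨n, hn⟩ := exists_nat_gt (f.1 x)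
  have h1 : (n : ℝ) + 1 ≤ f.1 x := Set.mem_iInter.1 hx n
  linarith

section Convergence

variable {f : ℕ → QuasiConcaveFunction N} {g : QuasiConcaveFunction N}

theorem tendsto_intrinsicVolume_of_tendsto_volume (k : Fin (N + 1)) {t : Set.Ioi (0 : ℝ)}
    (h : ∀ j : Fin (N + 1), Tendsto
      (fun i => volume.real (Metric.cthickening (steinerNode j) (levelSet (t : ℝ) (f i).1))) atTop
      (𝓝 (volume.real (Metric.cthickening (steinerNode j) (levelSet (t : ℝ) g.1))))) :
    Tendsto (fun i => intrinsicVolume k (levelSet (t : ℝ) (f i).1)) atTop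
      (𝓝 (intrinsicVolume k (levelSet (t : ℝ) g.1))) := by
  simp_rw [fun h : QuasiConcaveFunction N =>
    intrinsicVolume_eq_sum (h.isCompact_levelSet t) (h.convex_levelSet t) k]
  exact tendsto_finsetSum _ fun j _ => (h j).mul_const _

theorem tendsto_intrinsicVolume_levelSet_of_antitone (k : Fin (N + 1))
    (ha : Antitone fun i => (f i).1) (hlim : ∀ x, Tendsto (fun i => (f i).1 x) atTop (𝓝 (g.1 x)))
    (t : Set.Ioi (0 : ℝ)) :
    Tendsto (fun i => intrinsicVolume k (levelSet (t : ℝ) (f i).1)) atTop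
      (𝓝 (intrinsicVolume k (levelSet (t : ℝ) g.1))) := by
  have hI : levelSet (t : ℝ) g.1 = ⋂ i, levelSet (t : ℝ) (f i).1 := by
    ext x
    rw [Set.mem_iInter]
    refine ⟨fun hx i => ?_, fun hx => ge_of_tendsto' (hlim x) hx⟩
    exact le_trans hx
      (Antitone.le_of_tendsto (f := fun i => (f i).1 x) (fun i j hij => ha hij x) (hlim x) i)
  refine tendsto_intrinsicVolume_of_tendsto_volume k fun j => ?_
  rw [hI]
  exact tendsto_volume_cthickening_of_antitone (fun i => (f i).isCompact_levelSet t)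
    (fun i j hij => levelSet_subset_of_le (ha hij) t) (steinerNode_pos j).le

/-- The union of the sets `L_t(f_i)` may miss points where `g = t`, but it contains `L_s(g)` for
every `s > t`. This suffices where the antitone functions `Φ j` are continuous, hence off a
countable set. -/
theorem ae_tendsto_intrinsicVolume_levelSet_of_monotone (k : Fin (N + 1))
    (hm : Monotone fun i => (f i).1) (hlim : ∀ x, Tendsto (fun i => (f i).1 x) atTop (𝓝 (g.1 x)))
    (ν : Measure (Set.Ioi (0 : ℝ))) [NullSingletonClass ν] :
    ∀ᵐ t : Set.Ioi (0 : ℝ) ∂ν, Tendsto (fun i => intrinsicVolume k (levelSet (t : ℝ) (f i).1)) atTop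
      (𝓝 (intrinsicVolume k (levelSet (t : ℝ) g.1))) := by
  let Φ : Fin (N + 1) → Set.Ioi (0 : ℝ) → ℝ := fun j t =>
    volume.real (Metric.cthickening (steinerNode j) (levelSet (t : ℝ) g.1))
  have hΦ : ∀ j, Antitone (Φ j) := fun j s t hst =>
    measureReal_cthickening_mono (g.isCompact_levelSet s) (levelSet_antitone g.1 hst) _
  have hcont : ∀ᵐ t ∂ν, ∀ j, ContinuousAt (Φ j) t :=
    ae_all_iff.2 fun j => (hΦ j).countable_not_continuousAt.measure_zero ν
  filter_upwards [hcont] with t ht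
  refine tendsto_intrinsicVolume_of_tendsto_volume k fun j => tendsto_order.2 ⟨fun a ha => ?_,
    fun a ha => Eventually.of_forall fun i => lt_of_le_of_lt ?_ ha⟩
  · have h1 : ∀ᶠ s in 𝓝[>] t, a < Φ j s :=
      ((ht j).eventually_const_lt ha).filter_mono nhdsWithin_le_nhds
    obtain ⟨s, hs, hts⟩ := (h1.and self_mem_nhdsWithin).exists
    refine eventually_lt_volume_cthickening (fun i => (f i).isCompact_levelSet t)
      (fun i j hij => levelSet_subset_of_le (hm hij) t) (g.convex_levelSet s)
      (g.isCompact_levelSet s) (fun x hx => ?_) (steinerNode_pos j) hs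
    have hx' : (s : ℝ) ≤ g.1 x := hx
    have hts' : (t : ℝ) < s := hts
    obtain ⟨i, hi⟩ := ((hlim x).eventually_const_lt (hts'.trans_le hx')).exists
    exact Set.mem_iUnion.2 ⟨i, hi.le⟩
  · refine measureReal_cthickening_mono (g.isCompact_levelSet t) (levelSet_subset_of_le ?_ t) _
    exact fun x => Monotone.ge_of_tendsto (f := fun i => (f i).1 x)
      (fun i j hij => hm hij x) (hlim x) i

end Convergence

/-! ### Radial step functions as test functions -/

section StepFunction

open Classical in
/-- The radial function with value `t n` on the shell `R (n - 1) < ‖x‖ ≤ R n`. -/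
noncomputable def radialStep (t R : ℕ → ℝ) (hR : ∀ n : ℕ, (n : ℝ) ≤ R n)
    (x : EuclideanSpace ℝ (Fin N)) : ℝ :=
  t (Nat.find (p := fun n => ‖x‖ ≤ R n)
    ((exists_nat_ge ‖x‖).imp fun n h => h.trans (hR n)))

variable {t R : ℕ → ℝ} (hR : ∀ n : ℕ, (n : ℝ) ≤ R n)

theorem levelSet_radialStep (hRm : Monotone R) (ht : Antitone t) {n : ℕ} {s : ℝ}
    (hs : t (n + 1) < s) (hs' : s ≤ t n) :
    levelSet s (radialStep (N := N) t R hR) = Metric.closedBall 0 (R n) := by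
  ext x
  rw [mem_closedBall_zero_iff]
  change s ≤ t _ ↔ _
  constructor
  · intro h
    refine le_of_not_gt fun hx => absurd (hs.trans_le h) (not_lt.2 (ht ?_))
    rw [Nat.succ_le_iff, Nat.lt_find_iff]
    exact fun m hm => not_le.2 ((hRm hm).trans_lt hx)
  · exact fun h => hs'.trans (ht (Nat.find_min' _ h))

theorem levelSet_radialStep_of_lt (ht : Antitone t) {s : ℝ} (hs : t 0 < s) :
    levelSet s (radialStep (N := N) t R hR) = ∅ :=
  Set.eq_empty_of_forall_notMem fun _ hx =>
    absurd (hs.trans_le hx) (not_lt.2 (ht (Nat.zero_le _)))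

theorem exists_lt_and_le_of_tendsto_zero (ht0 : Tendsto t atTop (𝓝 0)) {s : ℝ} (hs : 0 < s)
    (hs' : s ≤ t 0) : ∃ n, t (n + 1) < s ∧ s ≤ t n := by
  classical
  have hex : ∃ n, t n < s := (ht0.eventually_lt_const hs).exists
  have hne : Nat.find hex ≠ 0 := fun h => absurd (Nat.find_spec hex) (by rw [h]; exact not_lt.2 hs')
  obtain ⟨n, hn⟩ := Nat.exists_eq_succ_of_ne_zero hne
  exact ⟨n, by rw [← Nat.succ_eq_add_one, ← hn]; exact Nat.find_spec hex,
    not_lt.1 (Nat.find_min hex (by omega))⟩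

/-- `radialStep` as an element of `𝒞^N`. -/
noncomputable def radialStepFunction (hRm : Monotone R) (ht : Antitone t)
    (ht0 : Tendsto t atTop (𝓝 0)) : QuasiConcaveFunction N :=
  ⟨radialStep t R hR, fun _ => ht.le_of_tendsto ht0 _, fun s hs => by
    rcases lt_or_ge (t 0) s with h | h
    · rw [levelSet_radialStep_of_lt hR ht h]
      exact ⟨isCompact_empty, convex_empty⟩
    · obtain ⟨n, h1, h2⟩ := exists_lt_and_le_of_tendsto_zero ht0 hs h
      rw [levelSet_radialStep hR hRm ht h1 h2]
      exact ⟨isCompact_closedBall _ _, convex_closedBall _ _⟩⟩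

end StepFunction

theorem isCompact_preimage_val_Icc {a : ℝ} (ha : 0 < a) (b : ℝ) :
    IsCompact ((↑) ⁻¹' Set.Icc a b : Set (Set.Ioi (0 : ℝ))) := by
  rw [Subtype.isCompact_iff, Subtype.image_preimage_coe, Set.inter_eq_self_of_subset_right]
  · exact isCompact_Icc
  · exact fun x hx => ha.trans_le hx.1

theorem intrinsicVolume_unitBall_pos (k : Fin (N + 1)) :
    0 < (N.choose k * unitBallVolume N / unitBallVolume (N - k) : ℝ) :=
  div_pos (mul_pos (Nat.cast_pos.2 (Nat.choose_pos (Nat.le_of_lt_succ k.2)))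
    (unitBallVolume_pos _)) (unitBallVolume_pos _)

/-! ### Consequences of integrability and dominated convergence -/

section Integrability

variable {k : Fin (N + 1)} {ν : Measure (Set.Ioi (0 : ℝ))} [IsFiniteMeasureOnCompacts ν]

theorem exists_pos_measure_Ioc {a : ℝ} (ha : 0 < a)
    (h : ν {t : Set.Ioi (0 : ℝ) | (t : ℝ) < a} ≠ 0) :
    ∃ b, 0 < b ∧ b ≤ a / 2 ∧ 0 < ν.real ((↑) ⁻¹' Set.Ioc b a : Set (Set.Ioi (0 : ℝ))) := by
  have hsub : {t : Set.Ioi (0 : ℝ) | (t : ℝ) < a} ⊆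
      ⋃ n : ℕ, ((↑) ⁻¹' Set.Ioc (1 / ((n : ℝ) + 1)) a : Set (Set.Ioi (0 : ℝ))) := fun t ht => by
    obtain ⟨n, hn⟩ := exists_nat_one_div_lt (show (0 : ℝ) < t from t.2)
    exact Set.mem_iUnion.2 ⟨n, hn, le_of_lt ht⟩
  obtain ⟨n, hn⟩ : ∃ n : ℕ, ν ((↑) ⁻¹' Set.Ioc (1 / ((n : ℝ) + 1)) a) ≠ 0 := by
    by_contra! h0
    exact h (measure_mono_null hsub (measure_iUnion_null h0))
  have hb : 0 < min (1 / ((n : ℝ) + 1)) (a / 2) := by positivity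
  refine ⟨_, hb, min_le_right _ _, ENNReal.toReal_pos ?_ ?_⟩
  · exact fun h0 => hn (measure_mono_null (Set.preimage_mono
      (Set.Ioc_subset_Ioc_left (min_le_left _ _))) h0)
  · exact ((measure_mono (Set.preimage_mono Set.Ioc_subset_Icc_self)).trans_lt
      (isCompact_preimage_val_Icc hb a).measure_lt_top).ne

/-- Otherwise levels `t n ↓ 0` exist with every `(t (n + 1), t n]` of positive mass. A radial step
function whose ball on that slab has radius at least the inverse mass gains at least `V_k(B)` from
each slab, contradicting integrability. -/
theorem exists_measure_lt_eq_zero (hk : k ≠ 0)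
    (hν : ∀ f : QuasiConcaveFunction N, Integrable
      (fun t : Set.Ioi (0 : ℝ) => intrinsicVolume k (levelSet (t : ℝ) f.1)) ν) :
    ∃ δ : ℝ, 0 < δ ∧ ν {t : Set.Ioi (0 : ℝ) | (t : ℝ) < δ} = 0 := by
  by_contra! h
  choose! next hpos hhalf hmass using
    fun (a : ℝ) (ha : 0 < a) => exists_pos_measure_Ioc ha (h a ha)
  let t : ℕ → ℝ := fun n => next^[n] 1
  have htsucc : ∀ n, t (n + 1) = next (t n) := fun n => Function.iterate_succ_apply' _ _ _
  have htpos : ∀ n, 0 < t n := fun n => by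
    induction n with
    | zero => exact one_pos
    | succ n ih => rw [htsucc]; exact hpos _ ih
  have ht : Antitone t := antitone_nat_of_succ_le fun n => by
    rw [htsucc]; linarith [hhalf _ (htpos n), htpos n]
  have htle : ∀ n, t n ≤ (1 / 2) ^ n := fun n => by
    induction n with
    | zero => exact le_of_eq (by simp [t])
    | succ n ih => rw [htsucc, pow_succ]; linarith [hhalf _ (htpos n)]
  have ht0 : Tendsto t atTop (𝓝 0) :=
    squeeze_zero (fun n => (htpos n).le) htle
      (tendsto_pow_atTop_nhds_zero_of_lt_one (by norm_num) (by norm_num))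
  let A : ℕ → Set (Set.Ioi (0 : ℝ)) := fun n => (↑) ⁻¹' Set.Ioc (t (n + 1)) (t n)
  have hA : ∀ n, 0 < ν.real (A n) := fun n => by
    simp only [A, htsucc]; exact hmass _ (htpos n)
  -- Partial sums make `R` monotone; the summand 1 gives `n ≤ R n`, so the balls exhaust space, and
  -- `1 ≤ R n`, so `R n ≤ R n ^ k`.
  let R : ℕ → ℝ := fun n => ∑ i ∈ Finset.range (n + 1), (1 + (ν.real (A i))⁻¹)
  have hterm : ∀ i, 0 < (ν.real (A i))⁻¹ := fun i => inv_pos.2 (hA i)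
  have hRm : Monotone R := monotone_nat_of_le_succ fun n => by
    simp only [R]
    rw [Finset.sum_range_succ _ (n + 1)]
    linarith [hterm (n + 1)]
  have hR : ∀ n : ℕ, (n : ℝ) ≤ R n := fun n => by
    simp only [R, Finset.sum_add_distrib, Finset.sum_const, Finset.card_range, nsmul_eq_mul,
      mul_one, Nat.cast_add, Nat.cast_one]
    linarith [Finset.sum_nonneg fun i (_ : i ∈ Finset.range (n + 1)) => (hterm i).le]
  have hR1 : ∀ n, 1 + (ν.real (A n))⁻¹ ≤ R n := fun n =>
    Finset.single_le_sum (f := fun i => 1 + (ν.real (A i))⁻¹)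
      (fun i _ => by linarith [hterm i]) (Finset.self_mem_range_succ n)
  set c : ℝ := N.choose k * unitBallVolume N / unitBallVolume (N - k)
  have hc : 0 < c := intrinsicVolume_unitBall_pos k
  let f : QuasiConcaveFunction N := radialStepFunction hR hRm ht ht0
  have hAm : ∀ n, MeasurableSet (A n) := fun n => measurable_subtype_coe measurableSet_Ioc
  have hint : ∀ n, c ≤ ∫ s in A n, intrinsicVolume k (levelSet (s : ℝ) f.1) ∂ν := fun n => by
    rw [setIntegral_congr_fun (g := fun _ => R n ^ (k : ℕ) * c) (hAm n) (fun s hs => by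
      change intrinsicVolume k (levelSet (s : ℝ) (radialStep t R hR)) = _
      rw [levelSet_radialStep hR hRm ht hs.1 hs.2,
        intrinsicVolume_closedBall (n.cast_nonneg.trans (hR n))]), setIntegral_const, smul_eq_mul,
      ← mul_assoc]
    refine le_mul_of_one_le_left hc.le ?_
    have h1 : (ν.real (A n))⁻¹ ≤ R n ^ (k : ℕ) :=
      calc (ν.real (A n))⁻¹ ≤ R n := by linarith [hR1 n]
        _ ≤ R n ^ (k : ℕ) := le_self_pow₀ (by linarith [hR1 n, hterm n])
          (fun h0 => hk (Fin.ext h0))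
    calc (1 : ℝ) = ν.real (A n) * (ν.real (A n))⁻¹ := (mul_inv_cancel₀ (hA n).ne').symm
      _ ≤ _ := mul_le_mul_of_nonneg_left h1 (hA n).le
  have hdisj : Pairwise (Function.onFun Disjoint A) := fun m n hmn =>
    (ht.pairwise_disjoint_on_Ioc_succ hmn).preimage _
  have hsum := (hasSum_integral_iUnion hAm hdisj (hν f).integrableOn).summable
  exact absurd (ge_of_tendsto' hsum.tendsto_atTop_zero hint) (not_le.2 hc)

/-- For `k = 0` the measure may charge every neighbourhood of 0, so `V_0(L_t(g))` itself is the
bound. For `k ≥ 1` almost every level is at least `δ`, and all relevant level sets lie in the single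
compact set `L_δ(g)`. -/
theorem exists_integrable_bound
    (hν : ∀ f : QuasiConcaveFunction N, Integrable
      (fun t : Set.Ioi (0 : ℝ) => intrinsicVolume k (levelSet (t : ℝ) f.1)) ν)
    (g : QuasiConcaveFunction N) :
    ∃ b : Set.Ioi (0 : ℝ) → ℝ, Integrable b ν ∧ ∀ᵐ t : Set.Ioi (0 : ℝ) ∂ν,
      ∀ f : QuasiConcaveFunction N, f.1 ≤ g.1 → ‖intrinsicVolume k (levelSet (t : ℝ) f.1)‖ ≤ b t := by
  by_cases hk : k = 0
  · subst hk
    refine ⟨_, hν g, Eventually.of_forall fun t f hfg => ?_⟩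
    rw [Real.norm_of_nonneg
      (intrinsicVolume_zero_nonneg (f.isCompact_levelSet t) (f.convex_levelSet t))]
    exact intrinsicVolume_zero_mono (f.isCompact_levelSet t) (f.convex_levelSet t)
      (g.isCompact_levelSet t) (g.convex_levelSet t) (levelSet_subset_of_le hfg t)
  · obtain ⟨δ, hδ, hδ0⟩ := exists_measure_lt_eq_zero hk hν
    obtain ⟨M, hM⟩ := g.exists_levelSet_eq_empty
    obtain ⟨C, hC, hCb⟩ := exists_abs_intrinsicVolume_le (g.2.2 δ hδ).1 k
    let S : Set (Set.Ioi (0 : ℝ)) := (↑) ⁻¹' Set.Icc δ M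
    have hS : MeasurableSet S := measurable_subtype_coe measurableSet_Icc
    refine ⟨S.indicator fun _ => C, (integrable_indicator_iff hS).2
      (integrableOn_const (isCompact_preimage_val_Icc hδ M).measure_lt_top.ne), ?_⟩
    have hae : ∀ᵐ t : Set.Ioi (0 : ℝ) ∂ν, δ ≤ (t : ℝ) := by
      rw [ae_iff]; simpa using hδ0
    filter_upwards [hae] with t ht f hfg
    have hsub := levelSet_subset_of_le hfg (t : ℝ)
    by_cases htM : M ≤ t
    · rw [Set.subset_eq_empty hsub (hM t htM), intrinsicVolume_empty, norm_zero]
      exact Set.indicator_nonneg (fun _ _ => hC) _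
    · rw [Set.indicator_of_mem (show t ∈ S from ⟨ht, (not_le.1 htM).le⟩)]
      exact hCb _ (hsub.trans (levelSet_antitone g.1 ht)) (f.isCompact_levelSet t)
        (f.convex_levelSet t)

theorem isMonotoneContinuous_integralValuation [NullSingletonClass ν]
    (hν : ∀ f : QuasiConcaveFunction N, Integrable
      (fun t : Set.Ioi (0 : ℝ) => intrinsicVolume k (levelSet (t : ℝ) f.1)) ν) :
    IsMonotoneContinuous (integralValuation (N := N) k ν) := by
  intro f g hmono hlim
  obtain ⟨G, hG⟩ : ∃ G : QuasiConcaveFunction N, ∀ i, (f i).1 ≤ G.1 := by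
    rcases hmono with hm | ha
    · exact ⟨g, fun i x => Monotone.ge_of_tendsto (f := fun i => (f i).1 x)
        (fun i j hij => hm hij x) (hlim x) i⟩
    · exact ⟨f 0, fun i => ha (Nat.zero_le i)⟩
  obtain ⟨b, hb, hbound⟩ := exists_integrable_bound hν G
  refine tendsto_integral_of_dominated_convergence b (fun i => (hν (f i)).aestronglyMeasurable) hb
    (fun i => ?_) ?_
  · filter_upwards [hbound] with t ht using ht (f i) (hG i)
  · rcases hmono with hm | ha
    · exact ae_tendsto_intrinsicVolume_levelSet_of_monotone k hm hlim ν
    · exact Eventually.of_forall (tendsto_intrinsicVolume_levelSet_of_antitone k ha hlim)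

end Integrability

/-! ### Continuity excludes atoms -/

section BallFunction

open Classical in
/-- The function `a • 1_B` for the unit ball `B`. -/
noncomputable def ballFunction (N : ℕ) (a : ℝ) (x : EuclideanSpace ℝ (Fin N)) : ℝ :=
  if ‖x‖ ≤ 1 then a else 0

theorem levelSet_ballFunction_of_le {a t : ℝ} (ht : 0 < t) (h : t ≤ a) :
    levelSet t (ballFunction N a) = Metric.closedBall 0 1 := by
  ext x
  rw [mem_closedBall_zero_iff]
  change t ≤ ite _ _ _ ↔ _
  split_ifs with hx
  · simp [h, hx]
  · simp [ht, hx]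

theorem levelSet_ballFunction_of_lt {a t : ℝ} (ht : 0 < t) (h : a < t) :
    levelSet t (ballFunction N a) = ∅ := by
  refine Set.eq_empty_of_forall_notMem fun x hx => ?_
  change t ≤ ite _ _ _ at hx
  split_ifs at hx <;> linarith

/-- `ballFunction` as an element of `𝒞^N`. -/
noncomputable def ballQuasiConcave (N : ℕ) (a : ℝ) (ha : 0 ≤ a) : QuasiConcaveFunction N :=
  ⟨ballFunction N a, fun x => by unfold ballFunction; split_ifs <;> simp [ha], fun t ht => by
    rcases le_or_gt t a with h | h
    · rw [levelSet_ballFunction_of_le ht h]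
      exact ⟨isCompact_closedBall _ _, convex_closedBall _ _⟩
    · rw [levelSet_ballFunction_of_lt ht h]
      exact ⟨isCompact_empty, convex_empty⟩⟩

theorem measure_singleton_eq_zero_of_isMonotoneContinuous {k : Fin (N + 1)}
    {ν : Measure (Set.Ioi (0 : ℝ))} [IsFiniteMeasureOnCompacts ν]
    (hν : ∀ f : QuasiConcaveFunction N, Integrable
      (fun t : Set.Ioi (0 : ℝ) => intrinsicVolume k (levelSet (t : ℝ) f.1)) ν)
    (hμ : IsMonotoneContinuous (integralValuation (N := N) k ν)) (s : Set.Ioi (0 : ℝ)) :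
    ν {s} = 0 := by
  have hs : (0 : ℝ) < s := s.2
  let a : ℕ → ℝ := fun i => s * (1 - 1 / ((i : ℝ) + 1))
  have hle1 : ∀ i : ℕ, 1 / ((i : ℝ) + 1) ≤ 1 := fun i => by
    rw [div_le_one (by positivity)]; linarith [i.cast_nonneg (α := ℝ)]
  have ha : ∀ i, 0 ≤ a i := fun i => mul_nonneg hs.le (sub_nonneg.2 (hle1 i))
  have has : ∀ i, a i < s := fun i => by
    have : 0 < 1 / ((i : ℝ) + 1) := by positivity
    simp only [a]; nlinarith
  have ham : Monotone a := fun i j hij =>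
    mul_le_mul_of_nonneg_left (sub_le_sub_left (Nat.one_div_le_one_div hij) 1) hs.le
  have hat : Tendsto a atTop (𝓝 s) := by
    simpa [a] using (tendsto_one_div_add_atTop_nhds_zero_nat.const_sub (1 : ℝ)).const_mul (s : ℝ)
  let f : ℕ → QuasiConcaveFunction N := fun i => ballQuasiConcave N (a i) (ha i)
  let g : QuasiConcaveFunction N := ballQuasiConcave N s hs.le
  have hlim := hμ f g (Or.inl fun i j hij x => ?_) fun x => ?_
  · set c : ℝ := N.choose k * unitBallVolume N / unitBallVolume (N - k) with hcdef
    have hc : 0 < c := intrinsicVolume_unitBall_pos k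
    have hV : ∀ b : ℝ, ∀ t : Set.Ioi (0 : ℝ),
        intrinsicVolume k (levelSet (t : ℝ) (ballFunction N b)) = if (t : ℝ) ≤ b then c else 0 :=
      fun b t => by
        split_ifs with h
        · rw [levelSet_ballFunction_of_le t.2 h, intrinsicVolume_closedBall zero_le_one, one_pow,
            one_mul]
        · rw [levelSet_ballFunction_of_lt t.2 (not_le.1 h), intrinsicVolume_empty]
    -- At level `s` the set for `g` is the unit ball while that for `f i` is empty; at other levels
    -- the difference of intrinsic volumes is nonnegative.
    have key : ∀ i, ν.real {s} * c ≤ integralValuation k ν g - integralValuation k ν (f i) :=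
      fun i => by
        rw [integralValuation, integralValuation, ← integral_sub (hν g) (hν (f i)),
          ← smul_eq_mul, ← setIntegral_const, ← integral_indicator (measurableSet_singleton s)]
        refine integral_mono ((integrable_indicator_iff (measurableSet_singleton s)).2
          (integrableOn_const isCompact_singleton.measure_lt_top.ne)) ((hν g).sub (hν (f i)))
          fun t => ?_
        change _ ≤ intrinsicVolume k (levelSet (t : ℝ) (ballFunction N s)) -
          intrinsicVolume k (levelSet (t : ℝ) (ballFunction N (a i)))
        rw [hV, hV]
        by_cases hts : t = s
        · subst hts
          simp [not_le.2 (has i)]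
        · rw [Set.indicator_of_notMem (by simpa using hts), sub_nonneg]
          split_ifs with h1 h2
          · rfl
          · exact absurd (h1.trans (has i).le) h2
          · exact hc.le
          · rfl
    have h0 : ν.real {s} * c ≤ 0 := by
      have := hlim.const_sub (integralValuation k ν g)
      rw [sub_self] at this
      exact ge_of_tendsto' this key
    have h1 : ν.real {s} = 0 :=
      le_antisymm (nonpos_of_mul_nonpos_left h0 hc) measureReal_nonneg
    exact (measureReal_eq_zero_iff isCompact_singleton.measure_lt_top.ne).1 h1
  · change ite _ _ _ ≤ ite _ _ _
    split_ifs
    · exact ham hij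
    · rfl
  · change Tendsto (fun i => ite _ _ _) _ (𝓝 (ite _ _ _))
    split_ifs
    · exact hat
    · exact tendsto_const_nhds

end BallFunction

end QuasiConcave

theorem proposition5p4 (N : ℕ) (hN : 1 ≤ N) (k : Fin (N + 1))
    (ν : MeasureTheory.Measure (Set.Ioi (0 : ℝ)))
    [MeasureTheory.IsFiniteMeasureOnCompacts ν]
    (hν : ∀ f : QuasiConcave.QuasiConcaveFunction N,
      MeasureTheory.Integrable
        (fun t : Set.Ioi (0 : ℝ) =>
          QuasiConcave.intrinsicVolume k (QuasiConcave.levelSet (t : ℝ) f.1)) ν) :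
    (∀ t : Set.Ioi (0 : ℝ), ν {t} = 0) ↔
      QuasiConcave.IsMonotoneContinuous (QuasiConcave.integralValuation (N := N) k ν) := by
  refine ⟨fun h => ?_,
    fun h t => QuasiConcave.measure_singleton_eq_zero_of_isMonotoneContinuous hν h t⟩
  have : MeasureTheory.NullSingletonClass ν := ⟨h⟩
  exact QuasiConcave.isMonotoneContinuous_integralValuation hν
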